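/- Let $G=(V,E)$ be a finite connected graph (parallel edges allowed) of genus $g=\#E-\#V+1\ge 2$. Suppose that $G$ is biconnected, i.e. it has no loop edges and remains connected after deleting any one vertex together with the edges incident to it. For edge lengths $\ell:E\to\mathbb R_{>0}$ let $\Gamma=(G,\ell)$ be the metric graph obtained by realizing each edge $e$ as a segment $[0,\ell(e)]$ and gluing along $V$. Let $\mathrm{Div}(\Gamma)$ be the free abelian group on the points of $\Gamma$. For a continuous piecewise linear function $f:\Gamma\to\mathbb R$ with integer slopes, let $\mathrm{div}(f)$ be the divisor whose coefficient at $x$ is minus the sum of the outgoing slopes of $f$ at $x$. Write $[D]$ for the class of $D$ in $\mathrm{Pic}(\Gamma)$, the quotient of $\mathrm{Div}(\Gamma)$ by the subgroup of all such $\mathrm{div}(f)$, and let $\mathrm{Jac}(\Gamma)\subset\mathrm{Pic}(\Gamma)$ be the subgroup of classes of divisors of degree $0$, with torsion subgroup $\mathrm{Jac}(\Gamma)_{\mathrm{tors}}$. For $q\in\Gamma$ let $\Phi_q:\Gamma\to\mathrm{Jac}(\Gamma)$, $x\mapsto[x-q]$, be the Abel–Jacobi map. The torsion packet of a class $[q]$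 with $q\in\Gamma$ is the set of all classes $[x]$, $x\in\Gamma$, with $[x-q]\in\mathrm{Jac}(\Gamma)_{\mathrm{tors}}$; we say that it contains the point $x$ if it contains $[x]$. Then for very general edge lengths, i.e. for all $\ell$ in a set of the form $\mathbb R_{>0}^{E}\cap S$, where $S\subset\mathbb R^{E}$ contains the complement of the union of the zero sets of some countable family of nonzero polynomials in $\mathbb R[x_e : e\in E]$, the following hold. 1. $\Gamma$ satisfies the Manin–Mumford condition: for every $q\in\Gamma$ the set $\Phi_q(\Gamma)\cap\mathrm{Jac}(\Gamma)_{\mathrm{tors}}$ is finite. 2. Every torsion packet of $\Gamma$ contains at most one point of each closed edge $e$ of $\Gamma$ (endpoints included). -/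

import Mathlib

namespace Tropical

/-! ### Finite oriented multigraphs -/

/-- A graph with vertex set `V` and edge set `E`; loops and parallel edges are allowed, and every
edge carries an (auxiliary) orientation from its tail to its head. -/
structure OrientedGraph (V E : Type*) where
  head : E → V
  tail : E → V

namespace OrientedGraph

variable {V E : Type*} (G : OrientedGraph V E)

/-- The underlying simple graph: two distinct vertices are adjacent if some edge of `G` lies
between them. It has the same connectivity as `G`. -/
def toSimpleGraph : SimpleGraph V :=
  SimpleGraph.fromRel fun v w => ∃ e, G.tail e = v ∧ G.head e = w

/-- `G` is connected (in particular nonempty). -/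
def IsConnected : Prop := G.toSimpleGraph.Connected

/-- `G` is biconnected: it is connected, it has no loop edges, and it stays connected after
deleting any one vertex together with all edges at that vertex. -/
def IsBiconnected : Prop :=
  G.IsConnected ∧ (∀ e, G.head e ≠ G.tail e) ∧
    ∀ v : V, (G.toSimpleGraph.induce {w | w ≠ v}).Preconnected

/-- The genus `#E - #V + 1` of a connected graph. -/
def genus (_G : OrientedGraph V E) [Fintype V] [Fintype E] : ℤ :=
  (Fintype.card E : ℤ) - (Fintype.card V : ℤ) + 1

end OrientedGraph

/-! ### Metric graphs -/

/-- A combinatorial model `(G, ℓ)` of a metric graph: a graph with positive edge lengths. -/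
structure MetricGraph (V E : Type*) where
  graph : OrientedGraph V E
  length : E → ℝ
  length_pos : ∀ e, 0 < length e

namespace MetricGraph

variable {V E : Type*} (Γ : MetricGraph V E)

/-- The points of the metric graph obtained by gluing a segment `[0, ℓ(e)]` for every edge `e` to
the tail of `e` (at `0`) and to the head of `e` (at `ℓ(e)`): a point is either a vertex or lies
in the interior of a unique edge, at a unique distance `t ∈ (0, ℓ(e))` from its tail. -/
inductive Point (Γ : MetricGraph V E)
  | vertex (v : V) : Point Γ
  | interior (e : E) (t : ℝ) (ht : 0 < t ∧ t < Γ.length e) : Point Γ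

open Classical in
/-- The length-preserving parametrisation `[0, ℓ(e)] → Γ` of the closed edge `e`, from its tail to
its head (extended to `ℝ` by constants). -/
noncomputable def edgePoint (e : E) (t : ℝ) : Γ.Point :=
  if h : 0 < t ∧ t < Γ.length e then .interior e t h
  else if t ≤ 0 then .vertex (Γ.graph.tail e)
  else .vertex (Γ.graph.head e)

/-- The closed edge `e`, as a set of points (including both endpoints). -/
def closedEdge (e : E) : Set Γ.Point := Γ.edgePoint e '' Set.Icc 0 (Γ.length e)

/-! ### Piecewise linear functions and their divisors -/

/-- `f` is a piecewise `ℤ`-linear function: every edge can be subdivided at a finite set `S` of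
parameters such that `f` is affine with integer slope on every closed segment `[a, b]` of the edge
with no point of `S` in its interior. (Continuity of `f` is automatic: the segments are closed,
and `f` has one value at every vertex.) -/
def IsPLZ (f : Γ.Point → ℝ) : Prop :=
  ∀ e, ∃ S : Finset ℝ, ∀ a b, 0 ≤ a → a < b → b ≤ Γ.length e →
    (∀ s ∈ S, s ∉ Set.Ioo a b) →
      ∃ m : ℤ, ∀ t ∈ Set.Icc a b,
        f (Γ.edgePoint e t) = f (Γ.edgePoint e a) + (m : ℝ) * (t - a)

/-- The slope of `f` on the edge `e` just after the parameter `t`, in the direction of increasing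
parameter. -/
noncomputable def slopeAfter (f : Γ.Point → ℝ) (e : E) (t : ℝ) : ℝ :=
  derivWithin (fun s => f (Γ.edgePoint e s)) (Set.Ici t) t

/-- The slope of `f` on the edge `e` just before the parameter `t`, in the direction of increasing
parameter. -/
noncomputable def slopeBefore (f : Γ.Point → ℝ) (e : E) (t : ℝ) : ℝ :=
  derivWithin (fun s => f (Γ.edgePoint e s)) (Set.Iic t) t

open Classical in
/-- The sum of the slopes of `f` at a point, over all directions leading away from the point.
At a vertex, each edge with tail there contributes its initial slope and each edge with head there
the negative of its final slope (a loop contributes both). -/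
noncomputable def outgoingSlopes [Fintype E] (f : Γ.Point → ℝ) : Γ.Point → ℝ
  | .vertex v =>
      (∑ e, if Γ.graph.tail e = v then Γ.slopeAfter f e 0 else 0) +
        ∑ e, if Γ.graph.head e = v then -Γ.slopeBefore f e (Γ.length e) else 0
  | .interior e t _ => Γ.slopeAfter f e t + -Γ.slopeBefore f e t

/-- The divisor group: the free abelian group on the points of `Γ`. -/
abbrev Divisor : Type _ := Γ.Point →₀ ℤ

/-- The degree homomorphism. -/
noncomputable def degree : Γ.Divisor →+ ℤ :=
  Finsupp.liftAddHom fun _ => AddMonoidHom.id ℤ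

/-- `D = div f`: the coefficient of `D` at every point is minus the sum of the outgoing slopes
of `f`. -/
def IsDivisorOf [Fintype E] (D : Γ.Divisor) (f : Γ.Point → ℝ) : Prop :=
  ∀ x, (D x : ℝ) = -Γ.outgoingSlopes f x

/-! The principal divisors of piecewise `ℤ`-linear functions form a subgroup. -/

variable {Γ}

lemma IsPLZ.zero : Γ.IsPLZ 0 := fun _ => ⟨∅, fun _ _ _ _ _ _ => ⟨0, by simp⟩⟩

lemma IsPLZ.add {f g : Γ.Point → ℝ} (hf : Γ.IsPLZ f) (hg : Γ.IsPLZ g) : Γ.IsPLZ (f + g) := by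
  classical
  intro e
  obtain ⟨S, hS⟩ := hf e
  obtain ⟨T, hT⟩ := hg e
  refine ⟨S ∪ T, fun a b ha hab hb h => ?_⟩
  obtain ⟨m, hm⟩ := hS a b ha hab hb fun s hs => h s (Finset.mem_union_left _ hs)
  obtain ⟨n, hn⟩ := hT a b ha hab hb fun s hs => h s (Finset.mem_union_right _ hs)
  refine ⟨m + n, fun t ht => ?_⟩
  simp only [Pi.add_apply, hm t ht, hn t ht]
  push_cast
  ring

lemma IsPLZ.neg {f : Γ.Point → ℝ} (hf : Γ.IsPLZ f) : Γ.IsPLZ (-f) := by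
  intro e
  obtain ⟨S, hS⟩ := hf e
  refine ⟨S, fun a b ha hab hb h => ?_⟩
  obtain ⟨m, hm⟩ := hS a b ha hab hb h
  refine ⟨-m, fun t ht => ?_⟩
  simp only [Pi.neg_apply, hm t ht]
  push_cast
  ring

lemma IsPLZ.differentiableAfter {f : Γ.Point → ℝ} (hf : Γ.IsPLZ f) (e : E) {t : ℝ}
    (h0 : 0 ≤ t) (h1 : t < Γ.length e) :
    DifferentiableWithinAt ℝ (fun s => f (Γ.edgePoint e s)) (Set.Ici t) t := by
  obtain ⟨S, hS⟩ := hf e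
  have hfin : ((S : Set ℝ) \ {t}).Finite := S.finite_toSet.subset Set.sdiff_subset
  have hev : ∀ᶠ u in nhds t, u ∉ (S : Set ℝ) \ {t} :=
    hfin.isClosed.isOpen_compl.mem_nhds (by simp)
  obtain ⟨ε, hε, hball⟩ := Metric.eventually_nhds_iff.1 hev
  have hlt : t < min (t + ε) (Γ.length e) := lt_min (by linarith) h1
  obtain ⟨m, hm⟩ := hS t (min (t + ε) (Γ.length e)) h0 hlt (min_le_right _ _) (by
    intro s hs hs'
    have h2 : s < t + ε := lt_of_lt_of_le hs'.2 (min_le_left _ _)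
    refine hball (y := s) ?_ ⟨hs, hs'.1.ne'⟩
    rw [Real.dist_eq, abs_lt]
    constructor <;> linarith [hs'.1])
  have hd : DifferentiableWithinAt ℝ
      (fun s => f (Γ.edgePoint e t) + (m : ℝ) * (s - t)) (Set.Ici t) t := by fun_prop
  refine hd.congr_of_eventuallyEq ?_ (by simp)
  have hmem : Set.Icc t (min (t + ε) (Γ.length e)) ∈ nhdsWithin t (Set.Ici t) :=
    Icc_mem_nhdsGE hlt
  filter_upwards [hmem] with s hs using hm s hs

lemma IsPLZ.differentiableBefore {f : Γ.Point → ℝ} (hf : Γ.IsPLZ f) (e : E) {t : ℝ}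
    (h0 : 0 < t) (h1 : t ≤ Γ.length e) :
    DifferentiableWithinAt ℝ (fun s => f (Γ.edgePoint e s)) (Set.Iic t) t := by
  obtain ⟨S, hS⟩ := hf e
  have hfin : ((S : Set ℝ) \ {t}).Finite := S.finite_toSet.subset Set.sdiff_subset
  have hev : ∀ᶠ u in nhds t, u ∉ (S : Set ℝ) \ {t} :=
    hfin.isClosed.isOpen_compl.mem_nhds (by simp)
  obtain ⟨ε, hε, hball⟩ := Metric.eventually_nhds_iff.1 hev
  have hlt : max (t - ε) 0 < t := max_lt (by linarith) h0
  obtain ⟨m, hm⟩ := hS (max (t - ε) 0) t (le_max_right _ _) hlt h1 (by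
    intro s hs hs'
    have h2 : t - ε < s := lt_of_le_of_lt (le_max_left _ _) hs'.1
    refine hball (y := s) ?_ ⟨hs, hs'.2.ne⟩
    rw [Real.dist_eq, abs_lt]
    constructor <;> linarith [hs'.2])
  have hd : DifferentiableWithinAt ℝ
      (fun s => f (Γ.edgePoint e (max (t - ε) 0)) + (m : ℝ) * (s - max (t - ε) 0))
      (Set.Iic t) t := by fun_prop
  have hmem : Set.Icc (max (t - ε) 0) t ∈ nhdsWithin t (Set.Iic t) := Icc_mem_nhdsLE hlt
  refine hd.congr_of_eventuallyEq ?_ (hm t ⟨hlt.le, le_rfl⟩)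
  filter_upwards [hmem] with s hs using hm s hs

lemma slopeAfter_add {f g : Γ.Point → ℝ} (hf : Γ.IsPLZ f) (hg : Γ.IsPLZ g) (e : E) {t : ℝ}
    (h0 : 0 ≤ t) (h1 : t < Γ.length e) :
    Γ.slopeAfter (f + g) e t = Γ.slopeAfter f e t + Γ.slopeAfter g e t :=
  derivWithin_fun_add (hf.differentiableAfter e h0 h1) (hg.differentiableAfter e h0 h1)

lemma slopeBefore_add {f g : Γ.Point → ℝ} (hf : Γ.IsPLZ f) (hg : Γ.IsPLZ g) (e : E) {t : ℝ}
    (h0 : 0 < t) (h1 : t ≤ Γ.length e) :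
    Γ.slopeBefore (f + g) e t = Γ.slopeBefore f e t + Γ.slopeBefore g e t :=
  derivWithin_fun_add (hf.differentiableBefore e h0 h1) (hg.differentiableBefore e h0 h1)

lemma slopeAfter_neg (f : Γ.Point → ℝ) (e : E) (t : ℝ) :
    Γ.slopeAfter (-f) e t = -Γ.slopeAfter f e t :=
  derivWithin.fun_neg

lemma slopeBefore_neg (f : Γ.Point → ℝ) (e : E) (t : ℝ) :
    Γ.slopeBefore (-f) e t = -Γ.slopeBefore f e t :=
  derivWithin.fun_neg

lemma outgoingSlopes_zero [Fintype E] (x : Γ.Point) : Γ.outgoingSlopes 0 x = 0 := by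
  cases x <;> simp [outgoingSlopes, slopeAfter, slopeBefore]

lemma outgoingSlopes_add [Fintype E] {f g : Γ.Point → ℝ} (hf : Γ.IsPLZ f) (hg : Γ.IsPLZ g)
    (x : Γ.Point) :
    Γ.outgoingSlopes (f + g) x = Γ.outgoingSlopes f x + Γ.outgoingSlopes g x := by
  cases x with
  | vertex v =>
    simp only [outgoingSlopes]
    simp only [← Finset.sum_add_distrib]
    refine Finset.sum_congr rfl fun e _ => ?_
    rw [slopeAfter_add hf hg e le_rfl (Γ.length_pos e),
      slopeBefore_add hf hg e (Γ.length_pos e) le_rfl]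
    split_ifs <;> ring
  | interior e t ht =>
    simp only [outgoingSlopes]
    rw [slopeAfter_add hf hg e ht.1.le ht.2, slopeBefore_add hf hg e ht.1 ht.2.le]
    ring

lemma outgoingSlopes_neg [Fintype E] (f : Γ.Point → ℝ) (x : Γ.Point) :
    Γ.outgoingSlopes (-f) x = -Γ.outgoingSlopes f x := by
  cases x with
  | vertex v =>
    simp only [outgoingSlopes, slopeAfter_neg, slopeBefore_neg]
    rw [neg_add]
    rw [← Finset.sum_neg_distrib, ← Finset.sum_neg_distrib]
    refine congrArg₂ (fun a b : ℝ => a + b) (Finset.sum_congr rfl fun e _ => ?_)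
      (Finset.sum_congr rfl fun e _ => ?_) <;> split_ifs <;> simp
  | interior e t ht =>
    simp only [outgoingSlopes, slopeAfter_neg, slopeBefore_neg]
    ring

variable (Γ)
variable [Fintype E]

/-- The group of principal divisors `div f`, for `f` piecewise `ℤ`-linear. -/
noncomputable def principal : AddSubgroup Γ.Divisor where
  carrier := {D | ∃ f, Γ.IsPLZ f ∧ Γ.IsDivisorOf D f}
  zero_mem' := ⟨0, IsPLZ.zero, fun x => by simp [outgoingSlopes_zero]⟩
  add_mem' := by
    rintro D D' ⟨f, hf, hD⟩ ⟨g, hg, hD'⟩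
    refine ⟨f + g, hf.add hg, fun x => ?_⟩
    rw [outgoingSlopes_add hf hg, Finsupp.add_apply, Int.cast_add, hD x, hD' x]
    ring
  neg_mem' := by
    rintro D ⟨f, hf, hD⟩
    refine ⟨-f, hf.neg, fun x => ?_⟩
    rw [outgoingSlopes_neg, Finsupp.neg_apply, Int.cast_neg, hD x]

/-! ### The Picard group, the Jacobian and the Abel--Jacobi map -/

/-- The Picard group of linear equivalence classes of divisors. -/
abbrev Pic : Type _ := Γ.Divisor ⧸ Γ.principal

/-- The linear equivalence class of a divisor. -/
noncomputable def divisorClass : Γ.Divisor →+ Γ.Pic := QuotientAddGroup.mk' Γ.principal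

/-- The Jacobian: the group of classes of divisors of degree `0`. -/
noncomputable def Jac : AddSubgroup Γ.Pic := Γ.degree.ker.map Γ.divisorClass

/-- The class `[x]` of a point. -/
noncomputable def pointClass (x : Γ.Point) : Γ.Pic := Γ.divisorClass (Finsupp.single x 1)

/-- The Abel--Jacobi map with basepoint `q`, sending `x` to `[x - q]`. -/
noncomputable def abelJacobi (q x : Γ.Point) : Γ.Jac :=
  ⟨Γ.divisorClass (Finsupp.single x 1 - Finsupp.single q 1),
    AddSubgroup.mem_map_of_mem _ (by
      rw [AddMonoidHom.mem_ker, map_sub]; simp [degree])⟩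

/-- The Manin--Mumford condition: for every basepoint `q`, the image of the Abel--Jacobi map
contains only finitely many torsion points of the Jacobian. -/
def ManinMumford : Prop :=
  ∀ q : Γ.Point, (Set.range (Γ.abelJacobi q) ∩ (AddCommGroup.torsion Γ.Jac : Set Γ.Jac)).Finite

/-- The effective divisor classes of degree one. -/
def effOne : Set Γ.Pic := Set.range Γ.pointClass

/-- The degree-one torsion packet of a class `c`: the effective classes of degree one that differ
from `c` by a torsion element of the Jacobian. -/
def torsionPacket (c : Γ.Pic) : Set Γ.Pic :=
  {d ∈ Γ.effOne | d - c ∈ (AddCommGroup.torsion Γ.Jac).map Γ.Jac.subtype}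

end MetricGraph

/-! ### Very general subsets -/

/-- A subset of `ℝ^ι` is very general if its complement is contained in the union of the zero loci
of countably many nonzero polynomials. -/
def IsVeryGeneral {ι : Type*} (S : Set (ι → ℝ)) : Prop :=
  ∃ F : Set (MvPolynomial ι ℝ), F.Countable ∧ (∀ p ∈ F, p ≠ 0) ∧
    {a | ∀ p ∈ F, MvPolynomial.eval a p ≠ 0} ⊆ S

/-- A very general subset of a parameter space `D`: the intersection of `D` with a very general
subset of `ℝ^ι`. -/
def IsVeryGeneralIn {ι : Type*} (D T : Set (ι → ℝ)) : Prop :=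
  ∃ S, IsVeryGeneral S ∧ T = D ∩ S

end Tropical

/-! It is enough that the edge lengths are linearly independent over `ℤ`. Suppose `n(x - y) = div f`
with `x`, `y` distinct points of one edge `e₀`. On every other edge `f` is affine, and the slopes
there form an integer flow conserved away from the ends of `e₀`; changing the value on `e₀` gives a
circulation `m'`.

The heart is `slopes_eq_zero`: these slopes vanish off `e₀`. By independence, `f(w) - f(tail e₀)`
has unique integer coordinates `F w e` with respect to the lengths, and the coordinate at `e`
changes only along `e` and `e₀`. Pairing it with `m'` gives `m'(e)² = m'(e₀)(F (tail e₀) e - F (head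
e₀) e)`, so every `e ≠ e₀` in the support of `m'` separates the ends of `e₀` in the graph without
`e₀`. Since there are no bridges (`exists_crosses_ne`), at most two support edges meet any level set
of `f` on vertices. If `f` is injective on vertices, all degrees are at most two and the genus is at
most one. Otherwise biconnectedness lets a level set be left through two different vertices, and
conservation puts two support edges at each, four in all.

So `f` is constant on the vertices, hence has no net change along `e₀`, and `n = 0`. Each torsion
packet thus has at most one point per closed edge; finiteness of the set of edges gives
Manin–Mumford. -/

namespace Tropical

/-! ### Edge cuts in biconnected graphs -/

namespace OrientedGraph

variable {V E : Type*} {G : OrientedGraph V E}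

/-- An edge crosses a set of vertices if exactly one of its endpoints lies in the set. -/
def Crosses (G : OrientedGraph V E) (e : E) (S : Set V) : Prop :=
  ¬(G.tail e ∈ S ↔ G.head e ∈ S)

lemma exists_edge_of_adj {x y : V} (h : G.toSimpleGraph.Adj x y) :
    ∃ e, (G.tail e = x ∧ G.head e = y) ∨ (G.tail e = y ∧ G.head e = x) := by
  rw [toSimpleGraph, SimpleGraph.fromRel_adj] at h
  obtain ⟨-, ⟨e, he⟩ | ⟨e, he⟩⟩ := h
  · exact ⟨e, Or.inl he⟩
  · exact ⟨e, Or.inr he⟩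

lemma exists_adj_of_preconnected {W : Type*} {H : SimpleGraph W} (hH : H.Preconnected)
    {S : Set W} {p q : W} (hp : p ∈ S) (hq : q ∉ S) : ∃ x ∈ S, ∃ y ∉ S, H.Adj x y := by
  obtain ⟨P⟩ := hH p q
  obtain ⟨d, -, h1, h2⟩ := P.exists_boundary_dart S hp hq
  exact ⟨d.fst, h1, d.snd, h2, d.adj⟩

lemma IsConnected.exists_crosses (hG : G.IsConnected) {S : Set V} {p q : V}
    (hp : p ∈ S) (hq : q ∉ S) : ∃ e, G.Crosses e S := by
  obtain ⟨x, hx, y, hy, h⟩ := exists_adj_of_preconnected hG.preconnected hp hq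
  obtain ⟨e, ⟨rfl, rfl⟩ | ⟨rfl, rfl⟩⟩ := exists_edge_of_adj h
  · exact ⟨e, by simp [Crosses, hx, hy]⟩
  · exact ⟨e, by simp [Crosses, hx, hy]⟩

lemma IsBiconnected.exists_crosses_avoiding (hG : G.IsBiconnected) (w : V) {S : Set V} {p q : V}
    (hp : p ∈ S) (hq : q ∉ S) (hpw : p ≠ w) (hqw : q ≠ w) :
    ∃ e, G.Crosses e S ∧ G.tail e ≠ w ∧ G.head e ≠ w := by
  obtain ⟨⟨x, hxw⟩, hx, ⟨y, hyw⟩, hy, h⟩ := exists_adj_of_preconnected (hG.2.2 w)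
    (S := Subtype.val ⁻¹' S) (p := ⟨p, hpw⟩) (q := ⟨q, hqw⟩) hp hq
  obtain ⟨e, ⟨rfl, rfl⟩ | ⟨rfl, rfl⟩⟩ := exists_edge_of_adj (SimpleGraph.induce_adj.1 h)
  · exact ⟨e, by simp_all [Crosses], hxw, hyw⟩
  · exact ⟨e, by simp_all [Crosses], hyw, hxw⟩

/-- A biconnected graph of genus at least two has no bridges. -/
lemma IsBiconnected.exists_crosses_ne [Fintype V] [Fintype E] (hG : G.IsBiconnected)
    (hg : 2 ≤ G.genus) (e : E) {S : Set V} {p q : V} (hp : p ∈ S) (hq : q ∉ S) :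
    ∃ e' ≠ e, G.Crosses e' S := by
  classical
  by_contra! hcon
  have key : ∀ e', G.Crosses e' S → e' = e := fun e' h => by
    by_contra hne
    exact hcon e' hne h
  obtain ⟨e', he'⟩ := hG.1.exists_crosses hp hq
  obtain rfl := key e' he'
  -- Here `y` is the end of the bridge on the side of a third vertex `x`. Deleting `y` leaves `x`
  -- joined to the other end, so some edge avoiding `y` crosses `S`; the bridge does not avoid `y`.
  have hin : ∀ x y, x ≠ G.tail e' → x ≠ G.head e' → (x ∈ S ↔ y ∈ S) →
      (y = G.tail e' ∨ y = G.head e') → False := by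
    intro x y hxt hxh hxy hy
    have : ∃ z, ((x ∈ S) ↔ z ∉ S) ∧ z ≠ y := by
      unfold Crosses at he'
      rcases hy with rfl | rfl
      · exact ⟨G.head e', by tauto, hG.2.1 e'⟩
      · exact ⟨G.tail e', by tauto, (hG.2.1 e').symm⟩
    obtain ⟨z, hz, hzy⟩ := this
    have hxy' : x ≠ y := by rcases hy with rfl | rfl <;> assumption
    have : ∃ d, G.Crosses d S ∧ G.tail d ≠ y ∧ G.head d ≠ y := by
      by_cases hx : x ∈ S
      · exact hG.exists_crosses_avoiding y hx (hz.1 hx) hxy' hzy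
      · exact hG.exists_crosses_avoiding y (not_not.1 (mt hz.2 hx)) hx hzy hxy'
    obtain ⟨d, hd, h1, h2⟩ := this
    obtain rfl := key d hd
    rcases hy with rfl | rfl
    · exact h1 rfl
    · exact h2 rfl
  have hV : ∀ x, x = G.tail e' ∨ x = G.head e' := by
    intro x
    by_contra! hx
    by_cases h : x ∈ S ↔ G.tail e' ∈ S
    · exact hin x _ hx.1 hx.2 h (Or.inl rfl)
    · refine hin x _ hx.1 hx.2 ?_ (Or.inr rfl)
      unfold Crosses at he'
      tauto
  -- With only two vertices and no loops every edge crosses `S`, so there is one edge and the genus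
  -- is too small.
  have hE : ∀ d, d = e' := by
    refine fun d => key d ?_
    have h0 := hG.2.1 d
    unfold Crosses at he' ⊢
    rcases hV (G.tail d) with h1 | h1 <;> rcases hV (G.head d) with h2 | h2
    · exact absurd (h2.trans h1.symm) h0
    · rwa [h1, h2]
    · rw [h1, h2]; tauto
    · exact absurd (h2.trans h1.symm) h0
  have hcE : Fintype.card E ≤ 1 :=
    Fintype.card_le_one_iff.2 fun a b => (hE a).trans (hE b).symm
  have hcV : 0 < Fintype.card V := Fintype.card_pos_iff.2 ⟨p⟩
  unfold genus at hg
  omega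

/-! ### Integer flows and circulations -/

open Classical in
/-- The net outflow of `m` at the vertex `w`. -/
noncomputable def netFlow [Fintype E] (G : OrientedGraph V E) (m : E → ℤ) (w : V) : ℤ :=
  ∑ e, m e * ((if G.tail e = w then 1 else 0) - (if G.head e = w then 1 else 0))

/-- Summation by parts. With `g = 1` the net flows add up to zero; with `g` a coordinate of the
potential it yields the quadratic relation behind `slopes_eq_zero`. -/
lemma sum_netFlow_mul [Fintype V] [Fintype E] (m : E → ℤ) (g : V → ℤ) :
    ∑ w, G.netFlow m w * g w = ∑ e, m e * (g (G.tail e) - g (G.head e)) := by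
  classical
  simp only [netFlow, Finset.sum_mul]
  rw [Finset.sum_comm]
  refine Finset.sum_congr rfl fun e _ => ?_
  simp only [mul_assoc, ← Finset.mul_sum, sub_mul, Finset.sum_sub_distrib, ite_mul, one_mul,
    zero_mul, Finset.sum_ite_eq, Finset.mem_univ, if_true]

lemma netFlow_update [Fintype E] [DecidableEq E] {e₀ : E}
    (m : E → ℤ) (k : ℤ) (w : V) :
    G.netFlow (Function.update m e₀ k) w = G.netFlow m w +
      (k - m e₀) * ((open Classical in if G.tail e₀ = w then 1 else 0) -
        (open Classical in if G.head e₀ = w then 1 else 0)) := by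
  classical
  unfold netFlow
  rw [← Finset.add_sum_erase _ _ (Finset.mem_univ e₀),
    ← Finset.add_sum_erase _ _ (Finset.mem_univ e₀)]
  rw [Finset.sum_congr rfl (g := fun e => m e * ((if G.tail e = w then 1 else 0) -
    (if G.head e = w then 1 else 0))) fun e he => by
      rw [Function.update_of_ne (Finset.ne_of_mem_erase he)]]
  simp only [Function.update_self]
  ring

/-- A flow that is conserved away from the endpoints of an edge becomes a circulation after
changing its value on this edge. -/
lemma exists_circulation [Fintype V] [Fintype E] {e₀ : E} (hne : G.head e₀ ≠ G.tail e₀)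
    (m : E → ℤ) (hm : ∀ w, w ≠ G.tail e₀ → w ≠ G.head e₀ → G.netFlow m w = 0) :
    ∃ m' : E → ℤ, (∀ e ≠ e₀, m' e = m e) ∧ ∀ w, G.netFlow m' w = 0 := by
  classical
  -- This value cancels the outflow at the tail; the head then balances because all net flows sum to
  -- zero.
  set m' := Function.update m e₀ (m e₀ - G.netFlow m (G.tail e₀)) with hm'
  have h1 : ∀ w ≠ G.head e₀, G.netFlow m' w = 0 := by
    intro w hw
    rw [hm', netFlow_update]
    by_cases h : G.tail e₀ = w
    · subst h
      simp [hne]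
    · rw [hm w (Ne.symm h) hw]
      simp [h, hw.symm]
  refine ⟨m', fun e he => Function.update_of_ne he _ _, fun w => ?_⟩
  by_cases hw : w = G.head e₀
  · subst hw
    have := sum_netFlow_mul (G := G) m' 1
    simp only [Pi.one_apply, mul_one, sub_self, mul_zero, Finset.sum_const_zero] at this
    rwa [Finset.sum_eq_single (G.head e₀) (fun w _ hw => h1 w hw) (by simp)] at this
  · exact h1 w hw

/-- The vertices with integer coordinates are closed under moving along any edge other than `e₀`,
and no proper nonempty vertex set is crossed by `e₀` alone. -/
lemma exists_coordinates [Fintype V] [Fintype E] (hG : G.IsBiconnected)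
    (hg : 2 ≤ G.genus) {ℓ : E → ℝ} (e₀ : E) (f : V → ℝ) (m : E → ℤ)
    (hf : ∀ e ≠ e₀, f (G.head e) - f (G.tail e) = m e * ℓ e) :
    ∃ F : V → E → ℤ, ∀ w, f w = f (G.tail e₀) + ∑ e, (F w e : ℝ) * ℓ e := by
  classical
  suffices h : ∀ w, ∃ c : E → ℤ, f w = f (G.tail e₀) + ∑ e, (c e : ℝ) * ℓ e from
    ⟨fun w => (h w).choose, fun w => (h w).choose_spec⟩
  intro w
  by_contra hw
  set S : Set V := {w | ∃ c : E → ℤ, f w = f (G.tail e₀) + ∑ e, (c e : ℝ) * ℓ e} with hS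
  have h0 : G.tail e₀ ∈ S := ⟨0, by simp⟩
  have hstep : ∀ (d : E) (j : ℤ) (x y : V), f y = f x + j * ℓ d → x ∈ S → y ∈ S := by
    rintro d j x y h ⟨c, hc⟩
    refine ⟨c + Pi.single d j, ?_⟩
    have : ∑ e, ((Pi.single d j : E → ℤ) e : ℝ) * ℓ e = j * ℓ d := by
      rw [Finset.sum_eq_single d] <;> simp +contextual
    simp only [Pi.add_apply, Int.cast_add, add_mul, Finset.sum_add_distrib, this]
    rw [h, hc]
    ring
  obtain ⟨d, hd, hcr⟩ := hG.exists_crosses_ne hg e₀ h0 hw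
  refine hcr ⟨hstep d (m d) _ _ (by linarith [hf d hd]), hstep d (-m d) _ _ ?_⟩
  push_cast
  linarith [hf d hd]

/-! ### Rigidity of integer slopes -/

/-- In a biconnected graph of genus at least two with `ℤ`-linearly independent edge lengths, a
potential whose slopes off one edge are integers and form a flow conserved away from the ends of
that edge has slope zero on all other edges. -/
theorem slopes_eq_zero [Fintype V] [Fintype E] (hG : G.IsBiconnected)
    (hg : 2 ≤ G.genus) {ℓ : E → ℝ} (hℓ : ∀ c : E → ℤ, ∑ e, (c e : ℝ) * ℓ e = 0 → c = 0)
    (e₀ : E) (f : V → ℝ) (m : E → ℤ)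
    (hf : ∀ e ≠ e₀, f (G.head e) - f (G.tail e) = m e * ℓ e)
    (hm : ∀ w, w ≠ G.tail e₀ → w ≠ G.head e₀ → G.netFlow m w = 0) :
    ∀ e ≠ e₀, m e = 0 := by
  classical
  obtain ⟨m', hmm', hcirc⟩ := exists_circulation (hG.2.1 e₀) m hm
  replace hf : ∀ e ≠ e₀, f (G.head e) - f (G.tail e) = m' e * ℓ e := fun e he => by
    rw [hmm' e he, hf e he]
  suffices h : ∀ e ≠ e₀, m' e = 0 from fun e he => (hmm' e he) ▸ h e he
  clear hm hmm' m
  obtain ⟨F, hF⟩ := exists_coordinates hG hg e₀ f m' hf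
  have hFinj : ∀ x y, f x = f y → F x = F y := by
    intro x y h
    rw [hF x, hF y] at h
    refine sub_eq_zero.1 (hℓ (F x - F y) ?_)
    simp only [Pi.sub_apply, Int.cast_sub, sub_mul, Finset.sum_sub_distrib]
    linarith
  have hFe : ∀ e ≠ e₀, F (G.head e) - F (G.tail e) = Pi.single e (m' e) := by
    intro e he
    refine sub_eq_zero.1 (hℓ _ ?_)
    have h1 := hf e he
    rw [hF (G.head e), hF (G.tail e)] at h1
    have : ∑ d, ((Pi.single e (m' e) : E → ℤ) d : ℝ) * ℓ d = m' e * ℓ e := by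
      rw [Finset.sum_eq_single e] <;> simp +contextual
    simp only [Pi.sub_apply, Int.cast_sub, sub_mul, Finset.sum_sub_distrib]
    linarith
  have hFne : ∀ e ≠ e₀, ∀ d ≠ e, F (G.head e) d = F (G.tail e) d := by
    intro e he d hd
    have := congrFun (hFe e he) d
    rw [Pi.single_eq_of_ne hd, Pi.sub_apply] at this
    linarith
  have hprod : ∀ e ≠ e₀, m' e ≠ 0 → m' e₀ * (F (G.tail e₀) e - F (G.head e₀) e) ≠ 0 := by
    intro e he hne h0
    have h1 := sum_netFlow_mul (G := G) m' fun w => F w e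
    simp only [hcirc, zero_mul, Finset.sum_const_zero] at h1
    rw [Finset.sum_eq_single e] at h1
    · have h2 := congrFun (hFe e he) e
      rw [Pi.single_eq_same, Pi.sub_apply] at h2
      have : m' e * m' e = 0 := by rw [← h2] at h1 ⊢; linarith
      exact hne (mul_self_eq_zero.1 this)
    · intro d _ hd
      by_cases hd0 : d = e₀
      · rw [hd0, h0]
      · rw [hFne d hd0 e hd.symm]; simp
    · simp
  have hcut : ∀ e ≠ e₀, m' e ≠ 0 → F (G.head e₀) e ≠ F (G.tail e₀) e := fun e he hne heq =>
    hprod e he hne (by rw [heq, sub_self, mul_zero])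
  intro e₁ he₁
  by_contra hm₁
  have huv : f (G.head e₀) ≠ f (G.tail e₀) := fun h =>
    hcut e₁ he₁ hm₁ (congrFun (hFinj _ _ h) e₁)
  have hm₀ : m' e₀ ≠ 0 := left_ne_zero_of_mul (hprod e₁ he₁ hm₁)
  -- an edge of the support that meets the level set of `a`
  let Meets : V → E → Prop := fun a e => m' e ≠ 0 ∧ (f (G.tail e) = f a ∨ f (G.head e) = f a)
  -- Each of `d₁`, `d₂` splits the vertices by whether the coordinate agrees with its value at the
  -- tail of `e₀`. If the level set of `a` is on the same side of both splittings, combining the two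
  -- gives a set crossed by `e₀` alone.
  have hpair : ∀ a, ∀ d₁ ≠ e₀, ∀ d₂ ≠ e₀, d₁ ≠ d₂ → Meets a d₁ → Meets a d₂ →
      (F a d₁ = F (G.tail e₀) d₁ ↔ F a d₂ = F (G.tail e₀) d₂) → False := by
    intro a d₁ h₁ d₂ h₂ h₁₂ M₁ M₂ hside
    have hc₁ := hcut d₁ h₁ M₁.1
    have hc₂ := hcut d₂ h₂ M₂.1
    have hM : ∀ d, Meets a d → F (G.tail d) = F a ∨ F (G.head d) = F a := fun d h =>
      h.2.imp (hFinj _ _) (hFinj _ _)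
    have hA₁ := hM d₁ M₁
    have hA₂ := hM d₂ M₂
    have n₁₂ := hFne d₁ h₁ d₂ h₁₂.symm
    have n₂₁ := hFne d₂ h₂ d₁ h₁₂
    by_cases ha : F a d₁ = F (G.tail e₀) d₁
    · have ha₂ := hside.1 ha
      -- On the tail side the union is used: one end of `d₁` is level with `a`, and `d₁` preserves
      -- the coordinate at `d₂`, so both its ends lie in the union; likewise for `d₂`.
      obtain ⟨d, hd, hcr⟩ := hG.exists_crosses_ne hg e₀
        (S := {w | F w d₁ = F (G.tail e₀) d₁ ∨ F w d₂ = F (G.tail e₀) d₂})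
        (p := G.tail e₀) (q := G.head e₀) (Or.inl rfl) (by simp [hc₁, hc₂])
      unfold Crosses at hcr
      simp only [Set.mem_ofPred_eq] at hcr
      by_cases hd₁ : d = d₁
      · subst hd₁
        rcases hA₁ with h | h
        · rw [n₁₂, h] at hcr; simp [ha, ha₂] at hcr
        · rw [← n₁₂, h] at hcr; simp [ha, ha₂] at hcr
      by_cases hd₂ : d = d₂
      · subst hd₂
        rcases hA₂ with h | h
        · rw [n₂₁, h] at hcr; simp [ha, ha₂] at hcr
        · rw [← n₂₁, h] at hcr; simp [ha, ha₂] at hcr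
      rw [hFne d hd d₁ (Ne.symm hd₁), hFne d hd d₂ (Ne.symm hd₂)] at hcr
      exact hcr Iff.rfl
    · have ha₂ := mt hside.2 ha
      -- Off the tail side the intersection is used: neither end of `d₁` or `d₂` lies in it.
      obtain ⟨d, hd, hcr⟩ := hG.exists_crosses_ne hg e₀
        (S := {w | F w d₁ = F (G.tail e₀) d₁ ∧ F w d₂ = F (G.tail e₀) d₂})
        (p := G.tail e₀) (q := G.head e₀) ⟨rfl, rfl⟩ (by simp [hc₁])
      unfold Crosses at hcr
      simp only [Set.mem_ofPred_eq] at hcr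
      by_cases hd₁ : d = d₁
      · subst hd₁
        rcases hA₁ with h | h
        · rw [n₁₂, h] at hcr; simp [ha, ha₂] at hcr
        · rw [← n₁₂, h] at hcr; simp [ha, ha₂] at hcr
      by_cases hd₂ : d = d₂
      · subst hd₂
        rcases hA₂ with h | h
        · rw [n₂₁, h] at hcr; simp [ha, ha₂] at hcr
        · rw [← n₂₁, h] at hcr; simp [ha, ha₂] at hcr
      rw [hFne d hd d₁ (Ne.symm hd₁), hFne d hd d₂ (Ne.symm hd₂)] at hcr
      exact hcr Iff.rfl
  have hpair₀ : ∀ a, ∀ d₁ ≠ e₀, ∀ d₂ ≠ e₀, d₁ ≠ d₂ → Meets a e₀ → Meets a d₁ → Meets a d₂ →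
      False := by
    intro a d₁ h₁ d₂ h₂ h₁₂ M₀ M₁ M₂
    refine hpair a d₁ h₁ d₂ h₂ h₁₂ M₁ M₂ ?_
    rcases M₀.2 with h | h
    · simp [hFinj _ _ h]
    · simp [← hFinj _ _ h, hcut d₁ h₁ M₁.1, hcut d₂ h₂ M₂.1]
  have hcard : ∀ a, (Finset.univ.filter (Meets a)).card ≤ 2 := by
    intro a
    by_contra! hlt
    obtain ⟨d₁, M₁, d₂, M₂, d₃, M₃, h₁₂, h₁₃, h₂₃⟩ := Finset.two_lt_card.1 hlt
    simp only [Finset.mem_filter, Finset.mem_univ, true_and] at M₁ M₂ M₃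
    by_cases h₁ : d₁ = e₀
    · subst h₁
      exact hpair₀ a d₂ h₁₂.symm d₃ h₁₃.symm h₂₃ M₁ M₂ M₃
    by_cases h₂ : d₂ = e₀
    · subst h₂
      exact hpair₀ a d₁ h₁ d₃ h₂₃.symm h₁₃ M₂ M₁ M₃
    by_cases h₃ : d₃ = e₀
    · subst h₃
      exact hpair₀ a d₁ h₁ d₂ h₂ h₁₂ M₃ M₁ M₂
    -- Three edges and two sides: two of the edges have `a` on the same side.
    have p₁₂ := hpair a d₁ h₁ d₂ h₂ h₁₂ M₁ M₂
    have p₁₃ := hpair a d₁ h₁ d₃ h₃ h₁₃ M₁ M₃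
    have p₂₃ := hpair a d₂ h₂ d₃ h₃ h₂₃ M₂ M₃
    tauto
  -- an edge is in the support exactly if its endpoints have different potentials
  have hsupp : ∀ e, f (G.tail e) = f (G.head e) → m' e = 0 := by
    intro e h
    by_cases he : e = e₀
    · subst he; exact absurd h.symm huv
    · have h2 := congrFun (hFe e he) e
      rw [Pi.single_eq_same, Pi.sub_apply, hFinj _ _ h, sub_self] at h2
      exact h2.symm
  have hsupp' : ∀ e, m' e = 0 → f (G.tail e) = f (G.head e) := by
    intro e h
    have he : e ≠ e₀ := fun he => hm₀ (he ▸ h)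
    have := hf e he
    rw [h] at this
    simp only [Int.cast_zero, zero_mul] at this
    linarith
  by_cases hinj : Function.Injective f
  · have hsub : ∀ w, (Finset.univ.filter fun e => G.tail e = w).card +
        (Finset.univ.filter fun e => G.head e = w).card ≤ 2 := by
      intro w
      rw [← Finset.card_union_of_disjoint]
      · refine (Finset.card_le_card fun e he => ?_).trans (hcard w)
        simp only [Finset.mem_union, Finset.mem_filter, Finset.mem_univ, true_and] at he ⊢
        exact ⟨fun h => hG.2.1 e (hinj (hsupp' e h)).symm,
          he.imp (congrArg f) (congrArg f)⟩
      · rw [Finset.disjoint_left]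
        intro e h1 h2
        simp only [Finset.mem_filter, Finset.mem_univ, true_and] at h1 h2
        exact hG.2.1 e (h2.trans h1.symm)
    have ht := Finset.card_eq_sum_card_fiberwise (s := (Finset.univ : Finset E))
      (t := (Finset.univ : Finset V)) (f := G.tail) (by simp)
    have hh := Finset.card_eq_sum_card_fiberwise (s := (Finset.univ : Finset E))
      (t := (Finset.univ : Finset V)) (f := G.head) (by simp)
    have hsum := Finset.sum_le_sum fun w (_ : w ∈ (Finset.univ : Finset V)) => hsub w
    rw [Finset.sum_add_distrib, ← ht, ← hh, Finset.sum_const] at hsum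
    simp only [Finset.card_univ, smul_eq_mul] at hsum
    unfold genus at hg
    omega
  · -- a level set with two vertices is left through two different vertices
    obtain ⟨p, q, hpq, hne⟩ : ∃ p q, f p = f q ∧ p ≠ q := by
      simpa [Function.Injective] using hinj
    have hout : ∃ z, f z ≠ f p := by
      by_contra! h
      exact huv ((h _).trans (h _).symm)
    obtain ⟨z, hz⟩ := hout
    -- If `b` is in the level set, connectedness after deleting `b` gives an exit elsewhere; if not,
    -- any exit is automatically different from `b`.
    have hleave : ∀ b, ∃ a ≠ b, f a = f p ∧ ∃ e, m' e ≠ 0 ∧ (G.tail e = a ∨ G.head e = a) := by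
      intro b
      have hex : ∃ x ∈ {w | f w = f p}, ∃ y ∉ {w | f w = f p}, x ≠ b ∧ (y ≠ b) ∨ b = z := by
        by_cases hb : p = b
        · exact ⟨q, hpq.symm, z, hz, by
            by_cases h : b = z
            · exact Or.inr h
            · exact Or.inl ⟨fun h' => hne (hb.trans h'.symm), Ne.symm h⟩⟩
        · exact ⟨p, rfl, z, hz, by
            by_cases h : b = z
            · exact Or.inr h
            · exact Or.inl ⟨hb, Ne.symm h⟩⟩
      obtain ⟨x, hx, y, hy, hxy⟩ := hex
      have hcr : ∃ e, G.Crosses e {w | f w = f p} ∧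
          (f b = f p → G.tail e ≠ b ∧ G.head e ≠ b) := by
        by_cases hb : f b = f p
        · have hbz : b ≠ z := fun h => hz (h ▸ hb)
          obtain ⟨h1, h2⟩ := hxy.resolve_right hbz
          obtain ⟨e, he, h3, h4⟩ := hG.exists_crosses_avoiding b hx hy h1 h2
          exact ⟨e, he, fun _ => ⟨h3, h4⟩⟩
        · obtain ⟨e, he⟩ := hG.1.exists_crosses hx hy
          exact ⟨e, he, fun h => absurd h hb⟩
      obtain ⟨e, he, havoid⟩ := hcr
      unfold Crosses at he
      simp only [Set.mem_ofPred_eq] at he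
      have hme : m' e ≠ 0 := fun h => he (by rw [hsupp' e h])
      by_cases ht : f (G.tail e) = f p
      · exact ⟨G.tail e, fun h => (havoid (h ▸ ht)).1 h, ht, e, hme, Or.inl rfl⟩
      · have hh : f (G.head e) = f p := by tauto
        exact ⟨G.head e, fun h => (havoid (h ▸ hh)).2 h, hh, e, hme, Or.inr rfl⟩
    -- A single nonzero value at a vertex cannot balance.
    have htwo : ∀ a, (∃ e, m' e ≠ 0 ∧ (G.tail e = a ∨ G.head e = a)) →
        1 < (Finset.univ.filter fun e => m' e ≠ 0 ∧ (G.tail e = a ∨ G.head e = a)).card := by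
      rintro a ⟨e, hme, hea⟩
      by_contra! hle
      have huniq : ∀ d, m' d ≠ 0 → (G.tail d = a ∨ G.head d = a) → d = e := fun d h1 h2 =>
        Finset.card_le_one.1 hle d (by simp [h1, h2]) e (by simp [hme, hea])
      have h0 := hcirc a
      unfold netFlow at h0
      rw [Finset.sum_eq_single e] at h0
      · rcases hea with h | h
        · have : G.head e ≠ a := fun h' => hG.2.1 e (h'.trans h.symm)
          simp [h, this, hme] at h0
        · have : G.tail e ≠ a := fun h' => hG.2.1 e (h.trans h'.symm)
          simp [h, this, hme] at h0
      · intro d _ hd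
        by_cases h1 : m' d = 0
        · simp [h1]
        · by_cases h2 : G.tail d = a ∨ G.head d = a
          · exact absurd (huniq d h1 h2) hd
          · push Not at h2
            simp [h2.1, h2.2]
      · simp
    obtain ⟨a₁, -, ha₁, hx₁⟩ := hleave z
    obtain ⟨a₂, ha₂₁, ha₂, hx₂⟩ := hleave a₁
    -- An edge joining `a₁` and `a₂` has ends of equal potential, so it is not in the support.
    have hdisj : Disjoint
        (Finset.univ.filter fun e => m' e ≠ 0 ∧ (G.tail e = a₁ ∨ G.head e = a₁))
        (Finset.univ.filter fun e => m' e ≠ 0 ∧ (G.tail e = a₂ ∨ G.head e = a₂)) := by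
      rw [Finset.disjoint_left]
      intro e h1 h2
      simp only [Finset.mem_filter, Finset.mem_univ, true_and] at h1 h2
      refine h1.1 (hsupp e ?_)
      rcases h1.2 with h3 | h3 <;> rcases h2.2 with h4 | h4
      · exact absurd (h4.symm.trans h3) ha₂₁
      · rw [h3, h4, ha₁, ha₂]
      · rw [h3, h4, ha₁, ha₂]
      · exact absurd (h4.symm.trans h3) ha₂₁
    have hle : (Finset.univ.filter fun e => m' e ≠ 0 ∧ (G.tail e = a₁ ∨ G.head e = a₁)) ∪
        (Finset.univ.filter fun e => m' e ≠ 0 ∧ (G.tail e = a₂ ∨ G.head e = a₂)) ⊆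
        Finset.univ.filter (Meets p) := by
      intro e he
      simp only [Finset.mem_union, Finset.mem_filter, Finset.mem_univ, true_and] at he
      simp only [Finset.mem_filter, Finset.mem_univ, true_and, Meets]
      rcases he with ⟨h, h' | h'⟩ | ⟨h, h' | h'⟩
      · exact ⟨h, Or.inl (by rw [h', ha₁])⟩
      · exact ⟨h, Or.inr (by rw [h', ha₁])⟩
      · exact ⟨h, Or.inl (by rw [h', ha₂])⟩
      · exact ⟨h, Or.inr (by rw [h', ha₂])⟩
    have h4 := (Finset.card_le_card hle).trans (hcard p)
    rw [Finset.card_union_of_disjoint hdisj] at h4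
    have := htwo a₁ hx₁
    have := htwo a₂ hx₂
    omega

end OrientedGraph

end Tropical

/-! ### Piecewise linear functions along an edge -/

namespace Tropical

namespace MetricGraph

variable {V E : Type*} {Γ : MetricGraph V E}

lemma edgePoint_zero (e : E) : Γ.edgePoint e 0 = .vertex (Γ.graph.tail e) := by
  simp [edgePoint]

lemma edgePoint_length (e : E) : Γ.edgePoint e (Γ.length e) = .vertex (Γ.graph.head e) := by
  simp [edgePoint, Γ.length_pos e]

lemma edgePoint_of_mem (e : E) {t : ℝ} (h : 0 < t ∧ t < Γ.length e) :
    Γ.edgePoint e t = .interior e t h := by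
  simp [edgePoint, h]

lemma slopeAfter_of_affine {f : Γ.Point → ℝ} {e : E} {a b m : ℝ} (hab : a < b)
    (h : ∀ t ∈ Set.Icc a b, f (Γ.edgePoint e t) = f (Γ.edgePoint e a) + m * (t - a)) :
    Γ.slopeAfter f e a = m := by
  have hd : HasDerivWithinAt (fun s => f (Γ.edgePoint e a) + m * (s - a)) m (Set.Ici a) a := by
    simpa using ((((hasDerivAt_id a).sub_const a).const_mul m).const_add
      (f (Γ.edgePoint e a))).hasDerivWithinAt (s := Set.Ici a)
  refine (hd.congr_of_eventuallyEq ?_ (by simp)).derivWithin (uniqueDiffWithinAt_Ici a)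
  filter_upwards [Icc_mem_nhdsGE hab] with s hs using h s hs

lemma slopeBefore_of_affine {f : Γ.Point → ℝ} {e : E} {a b m : ℝ} (hab : a < b)
    (h : ∀ t ∈ Set.Icc a b, f (Γ.edgePoint e t) = f (Γ.edgePoint e a) + m * (t - a)) :
    Γ.slopeBefore f e b = m := by
  have hd : HasDerivWithinAt (fun s => f (Γ.edgePoint e a) + m * (s - a)) m (Set.Iic b) b := by
    simpa using ((((hasDerivAt_id b).sub_const a).const_mul m).const_add
      (f (Γ.edgePoint e a))).hasDerivWithinAt (s := Set.Iic b)
  refine (hd.congr_of_eventuallyEq ?_ (h b ⟨hab.le, le_rfl⟩)).derivWithin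
    (uniqueDiffWithinAt_Iic b)
  filter_upwards [Icc_mem_nhdsLE hab] with s hs using h s hs

/-- A piecewise `ℤ`-linear function that does not bend inside a segment of an edge is affine
there. -/
lemma IsPLZ.affine {f : Γ.Point → ℝ} (hf : Γ.IsPLZ f) (e : E) {a b : ℝ} (ha : 0 ≤ a)
    (hab : a < b) (hb : b ≤ Γ.length e)
    (h : ∀ t ∈ Set.Ioo a b, Γ.slopeAfter f e t = Γ.slopeBefore f e t) :
    ∃ m : ℤ, ∀ t ∈ Set.Icc a b,
      f (Γ.edgePoint e t) = f (Γ.edgePoint e a) + (m : ℝ) * (t - a) := by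
  classical
  obtain ⟨S, hS⟩ := hf e
  induction hn : (S.filter (· ∈ Set.Ioo a b)).card using Nat.strong_induction_on
    generalizing a b with
  | _ n ih =>
    by_cases hc : ∀ s ∈ S, s ∉ Set.Ioo a b
    · exact hS a b ha hab hb hc
    · push Not at hc
      obtain ⟨s, hsS, has, hsb⟩ := hc
      have hlt : ∀ a' b', a ≤ a' → b' ≤ b → s ∉ Set.Ioo a' b' →
          (S.filter (· ∈ Set.Ioo a' b')).card < n := by
        intro a' b' h1 h2 h3
        rw [← hn]
        refine Finset.card_lt_card (Finset.ssubset_iff_of_subset ?_ |>.2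
          ⟨s, by simp [hsS, has, hsb], fun hs => h3 (Finset.mem_filter.1 hs).2⟩)
        intro x hx
        rw [Finset.mem_filter] at hx ⊢
        exact ⟨hx.1, h1.trans_lt hx.2.1, hx.2.2.trans_le h2⟩
      obtain ⟨m₁, h₁⟩ := ih _ (hlt a s le_rfl hsb.le (by simp)) ha has (hsb.le.trans hb)
        (fun t ht => h t ⟨ht.1, ht.2.trans hsb⟩) rfl
      obtain ⟨m₂, h₂⟩ := ih _ (hlt s b has.le le_rfl (by simp)) (ha.trans has.le) hsb hb
        (fun t ht => h t ⟨has.trans ht.1, ht.2⟩) rfl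
      -- Absence of a bend at the subdivision point `s` makes the two slopes agree, so the pieces
      -- merge.
      have hm : (m₂ : ℝ) = m₁ := by
        rw [← slopeAfter_of_affine hsb h₂, ← slopeBefore_of_affine has h₁]
        exact h s ⟨has, hsb⟩
      refine ⟨m₁, fun t ht => ?_⟩
      rcases le_total t s with hts | hts
      · exact h₁ t ⟨ht.1, hts⟩
      · rw [h₂ t ⟨hts, ht.2⟩, h₁ s ⟨has.le, le_rfl⟩, hm]
        ring

lemma edgePoint_eq_edgePoint_interior {e e' : E} {s t : ℝ} (ht : 0 < t ∧ t < Γ.length e')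
    (h : Γ.edgePoint e s = Γ.edgePoint e' t) : e = e' ∧ s = t := by
  rw [edgePoint_of_mem e' ht, edgePoint] at h
  split_ifs at h
  cases h
  exact ⟨rfl, rfl⟩

lemma edgePoint_eq_vertex {e : E} {s : ℝ} {w : V} (h : Γ.edgePoint e s = .vertex w) :
    s ≤ 0 ∧ w = Γ.graph.tail e ∨ Γ.length e ≤ s ∧ w = Γ.graph.head e := by
  rw [edgePoint] at h
  split_ifs at h with h1 h2
  · cases h
    exact Or.inl ⟨h2, rfl⟩
  · cases h
    push Not at h1 h2
    exact Or.inr ⟨h1 h2, rfl⟩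

/-- Only the parameters `0` and `ℓ(e)` could give the same point, and looplessness excludes this. -/
lemma edgePoint_ne (e : E) (hne : Γ.graph.head e ≠ Γ.graph.tail e) {s t : ℝ}
    (hs : 0 ≤ s) (hst : s < t) (ht : t ≤ Γ.length e) :
    Γ.edgePoint e s ≠ Γ.edgePoint e t := by
  intro h
  rcases ht.lt_or_eq with h1 | rfl
  · exact hst.ne (edgePoint_eq_edgePoint_interior ⟨hs.trans_lt hst, h1⟩ h).2
  · rw [edgePoint_length] at h
    rcases edgePoint_eq_vertex h with ⟨-, h2⟩ | ⟨h2, -⟩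
    · exact hne h2
    · exact absurd hst h2.not_gt

lemma exists_edgePoint_eq (hv : ∀ v, ∃ e, Γ.graph.tail e = v ∨ Γ.graph.head e = v)
    (x : Γ.Point) : ∃ e, x ∈ Γ.closedEdge e := by
  cases x with
  | vertex v =>
    obtain ⟨e, rfl | rfl⟩ := hv v
    · exact ⟨e, 0, ⟨le_rfl, (Γ.length_pos e).le⟩, edgePoint_zero e⟩
    · exact ⟨e, _, ⟨(Γ.length_pos e).le, le_rfl⟩, edgePoint_length e⟩
  | interior e t ht => exact ⟨e, t, ⟨ht.1.le, ht.2.le⟩, edgePoint_of_mem e ht⟩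

/-! ### Principal divisors supported on one edge -/

variable [Fintype E]

lemma IsDivisorOf.slopeAfter_eq {D : Γ.Divisor} {f : Γ.Point → ℝ} (h : Γ.IsDivisorOf D f)
    (e : E) {t : ℝ} (ht : 0 < t ∧ t < Γ.length e) :
    (D (Γ.edgePoint e t) : ℝ) = Γ.slopeBefore f e t - Γ.slopeAfter f e t := by
  rw [h, edgePoint_of_mem e ht, outgoingSlopes]
  ring

lemma IsDivisorOf.affine {D : Γ.Divisor} {f : Γ.Point → ℝ} (hf : Γ.IsPLZ f)
    (h : Γ.IsDivisorOf D f) (e : E) {a b : ℝ} (ha : 0 ≤ a) (hab : a < b) (hb : b ≤ Γ.length e)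
    (hD : ∀ t ∈ Set.Ioo a b, D (Γ.edgePoint e t) = 0) :
    ∃ m : ℤ, ∀ t ∈ Set.Icc a b,
      f (Γ.edgePoint e t) = f (Γ.edgePoint e a) + (m : ℝ) * (t - a) := by
  refine hf.affine e ha hab hb fun t ht => ?_
  have := h.slopeAfter_eq e ⟨ha.trans_lt ht.1, ht.2.trans_le hb⟩
  rw [hD t ht, Int.cast_zero] at this
  linarith

/-- Only the slopes at ends lying at `v` matter, so `m` may be chosen per vertex: an edge that bends
inside gets its initial slope at the tail and its final slope at the head. -/
lemma IsDivisorOf.vertex_eq {D : Γ.Divisor} {f : Γ.Point → ℝ} (h : Γ.IsDivisorOf D f) {m : E → ℝ}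
    {v : V} (h₀ : ∀ e, Γ.graph.tail e = v → Γ.slopeAfter f e 0 = m e)
    (h₁ : ∀ e, Γ.graph.head e = v → Γ.slopeBefore f e (Γ.length e) = m e) :
    (D (.vertex v) : ℝ) = -∑ e, m e * ((open Classical in if Γ.graph.tail e = v then 1 else 0) -
      (open Classical in if Γ.graph.head e = v then 1 else 0)) := by
  rw [h, outgoingSlopes, ← Finset.sum_add_distrib]
  congr 1
  refine Finset.sum_congr rfl fun e _ => ?_
  by_cases ht : Γ.graph.tail e = v <;> by_cases hh : Γ.graph.head e = v <;>
    simp [ht, hh, h₀, h₁]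

/-- A nonzero multiple of the difference of two different points of a closed edge is not
principal, if the graph is biconnected of genus at least two and the edge lengths are
`ℤ`-linearly independent. -/
theorem eq_zero_of_zsmul_sub_mem_principal [Fintype V] (hG : Γ.graph.IsBiconnected)
    (hg : 2 ≤ Γ.graph.genus)
    (hℓ : ∀ c : E → ℤ, ∑ e, (c e : ℝ) * Γ.length e = 0 → c = 0) {e₀ : E} {s t : ℝ}
    (hs : 0 ≤ s) (hst : s < t) (ht : t ≤ Γ.length e₀) {n : ℤ}
    (hD : n • (Finsupp.single (Γ.edgePoint e₀ s) 1 - Finsupp.single (Γ.edgePoint e₀ t) 1) ∈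
      Γ.principal) : n = 0 := by
  classical
  obtain ⟨f, hf, hdiv⟩ := hD
  set D : Γ.Divisor :=
    n • (Finsupp.single (Γ.edgePoint e₀ s) 1 - Finsupp.single (Γ.edgePoint e₀ t) 1) with hDdef
  have hne := hG.2.1 e₀
  have hxy := edgePoint_ne e₀ hne hs hst ht
  have hD0 : ∀ p, p ≠ Γ.edgePoint e₀ s → p ≠ Γ.edgePoint e₀ t → D p = 0 := by
    intro p h1 h2
    simp [hDdef, h1.symm, h2.symm]
  have hDx : D (Γ.edgePoint e₀ s) = n := by
    simp [hDdef, hxy.symm]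
  have hD' : ∀ e τ, 0 < τ ∧ τ < Γ.length e → e ≠ e₀ ∨ (τ ≠ s ∧ τ ≠ t) →
      D (Γ.edgePoint e τ) = 0 := by
    intro e τ hτ h
    refine hD0 _ (fun h' => ?_) fun h' => ?_
    · obtain ⟨rfl, rfl⟩ := edgePoint_eq_edgePoint_interior hτ h'.symm
      simp at h
    · obtain ⟨rfl, rfl⟩ := edgePoint_eq_edgePoint_interior hτ h'.symm
      simp at h
  have haff : ∀ e, e ≠ e₀ → ∃ m : ℤ, ∀ τ ∈ Set.Icc 0 (Γ.length e),
      f (Γ.edgePoint e τ) = f (Γ.edgePoint e 0) + (m : ℝ) * (τ - 0) := fun e he =>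
    hdiv.affine hf e le_rfl (Γ.length_pos e) le_rfl fun τ hτ => hD' e τ hτ (Or.inl he)
  choose! m hm using haff
  have hafter : ∀ e ≠ e₀, Γ.slopeAfter f e 0 = m e := fun e he =>
    slopeAfter_of_affine (Γ.length_pos e) (hm e he)
  have hbefore : ∀ e ≠ e₀, Γ.slopeBefore f e (Γ.length e) = m e := fun e he =>
    slopeBefore_of_affine (Γ.length_pos e) (hm e he)
  have hdiff : ∀ e ≠ e₀, f (.vertex (Γ.graph.head e)) - f (.vertex (Γ.graph.tail e)) =
      m e * Γ.length e := by
    intro e he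
    have := hm e he _ ⟨(Γ.length_pos e).le, le_rfl⟩
    rw [edgePoint_length, edgePoint_zero] at this
    rw [this]
    ring
  have hflow : ∀ w, w ≠ Γ.graph.tail e₀ → w ≠ Γ.graph.head e₀ → Γ.graph.netFlow m w = 0 := by
    intro w h1 h2
    have hw : ∀ τ, (.vertex w : Γ.Point) ≠ Γ.edgePoint e₀ τ := by
      intro τ h
      rcases edgePoint_eq_vertex h.symm with ⟨-, h'⟩ | ⟨-, h'⟩
      exacts [h1 h', h2 h']
    have := hdiv.vertex_eq (m := fun e => (m e : ℝ)) (v := w)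
      (fun e he => hafter e fun h => h1 (h ▸ he.symm))
      (fun e he => hbefore e fun h => h2 (h ▸ he.symm))
    rw [hD0 _ (hw s) (hw t), Int.cast_zero, zero_eq_neg] at this
    unfold OrientedGraph.netFlow
    exact_mod_cast this
  have hm0 := OrientedGraph.slopes_eq_zero hG hg hℓ e₀ (fun v => f (.vertex v)) m hdiff hflow
  -- `f` is unchanged along every edge other than `e₀`, and `e₀` alone is not a cut.
  have hends : f (.vertex (Γ.graph.head e₀)) = f (.vertex (Γ.graph.tail e₀)) := by
    by_contra hcon
    obtain ⟨e, he, hcr⟩ := hG.exists_crosses_ne hg e₀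
      (S := {w | f (.vertex w) = f (.vertex (Γ.graph.tail e₀))}) rfl hcon
    have := hdiff e he
    rw [hm0 e he, Int.cast_zero, zero_mul, sub_eq_zero] at this
    exact hcr (by simp [this])
  have htail : (D (.vertex (Γ.graph.tail e₀)) : ℝ) = -Γ.slopeAfter f e₀ 0 := by
    rw [hdiv.vertex_eq (m := Function.update 0 e₀ (Γ.slopeAfter f e₀ 0)),
      Finset.sum_eq_single e₀ (by simp +contextual) (by simp)]
    · simp [hne]
    · intro e _
      by_cases he : e = e₀
      · subst he; simp
      · simp [he, hafter, hm0]
    · intro e h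
      have he : e ≠ e₀ := fun he => hne (he ▸ h)
      simp [he, hbefore, hm0]
  have hhead : (D (.vertex (Γ.graph.head e₀)) : ℝ) = Γ.slopeBefore f e₀ (Γ.length e₀) := by
    rw [hdiv.vertex_eq (m := Function.update 0 e₀ (Γ.slopeBefore f e₀ (Γ.length e₀))),
      Finset.sum_eq_single e₀ (by simp +contextual) (by simp)]
    · simp [hne.symm]
    · intro e h
      have he : e ≠ e₀ := fun he => hne (he ▸ h.symm)
      simp [he, hafter, hm0]
    · intro e _
      by_cases he : e = e₀
      · subst he; simp
      · simp [he, hbefore, hm0]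
  -- If `0 < s`, the divisor vanishes at the tail of `e₀`, so the initial slope is zero and persists
  -- up to `s`.
  have hstart : f (Γ.edgePoint e₀ s) = f (.vertex (Γ.graph.tail e₀)) ∧
      (0 < s → Γ.slopeBefore f e₀ s = 0) := by
    rcases hs.eq_or_lt with rfl | hs'
    · exact ⟨by rw [edgePoint_zero], fun h => absurd h (lt_irrefl _)⟩
    · obtain ⟨α, hα⟩ := hdiv.affine hf e₀ le_rfl hs' (hst.le.trans ht) fun τ hτ =>
        hD' e₀ τ ⟨hτ.1, hτ.2.trans (hst.trans_le ht)⟩ (Or.inr ⟨hτ.2.ne, (hτ.2.trans hst).ne⟩)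
      have h0 : D (.vertex (Γ.graph.tail e₀)) = 0 := by
        rw [← edgePoint_zero]
        exact hD0 _ (edgePoint_ne e₀ hne le_rfl hs' (hst.le.trans ht))
          (edgePoint_ne e₀ hne le_rfl (hs'.trans hst) ht)
      rw [h0, slopeAfter_of_affine hs' hα, Int.cast_zero, zero_eq_neg] at htail
      refine ⟨?_, fun _ => (slopeBefore_of_affine hs' hα).trans htail⟩
      rw [hα s ⟨hs'.le, le_rfl⟩, htail, edgePoint_zero]
      ring
  have hend : f (Γ.edgePoint e₀ t) = f (.vertex (Γ.graph.head e₀)) := by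
    rcases ht.eq_or_lt with rfl | ht'
    · rw [edgePoint_length]
    · obtain ⟨γ, hγ⟩ := hdiv.affine hf e₀ (hs.trans hst.le) ht' le_rfl fun τ hτ =>
        hD' e₀ τ ⟨hs.trans_lt (hst.trans hτ.1), hτ.2⟩ (Or.inr ⟨(hst.trans hτ.1).ne', hτ.1.ne'⟩)
      have h0 : D (.vertex (Γ.graph.head e₀)) = 0 := by
        rw [← edgePoint_length]
        exact hD0 _ (edgePoint_ne e₀ hne hs (hst.trans ht') le_rfl).symm
          (edgePoint_ne e₀ hne (hs.trans hst.le) ht' le_rfl).symm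
      rw [h0, slopeBefore_of_affine ht' hγ, Int.cast_zero] at hhead
      rw [← edgePoint_length, hγ _ ⟨ht'.le, le_rfl⟩, ← hhead]
      ring
  -- Between `s` and `t` the function is affine with equal end values, so it has slope zero; hence
  -- it does not bend at `s`, where the coefficient is `n`.
  obtain ⟨β, hβ⟩ := hdiv.affine hf e₀ hs hst ht fun τ hτ =>
    hD' e₀ τ ⟨hs.trans_lt hτ.1, hτ.2.trans_le ht⟩ (Or.inr ⟨hτ.1.ne', hτ.2.ne⟩)
  have hβ0 : (β : ℝ) = 0 := by
    have := hβ t ⟨hst.le, le_rfl⟩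
    rw [hend, hstart.1, hends, left_eq_add] at this
    exact (mul_eq_zero.1 this).resolve_right (sub_pos.2 hst).ne'
  have hmid := (slopeAfter_of_affine hst hβ).trans hβ0
  have hn : (n : ℝ) = 0 := by
    rcases hs.eq_or_lt with rfl | hs'
    · rw [← hDx, edgePoint_zero, htail, hmid, neg_zero]
    · rw [← hDx, hdiv.slopeAfter_eq e₀ ⟨hs', hst.trans_le ht⟩, hmid, hstart.2 hs', sub_zero]
  exact_mod_cast hn

/-! ### Torsion packets and the Manin–Mumford condition -/

lemma exists_nsmul_sub_mem_principal {c : Γ.Pic} {x y : Γ.Point}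
    (hx : Γ.pointClass x ∈ Γ.torsionPacket c) (hy : Γ.pointClass y ∈ Γ.torsionPacket c) :
    ∃ n : ℕ, 0 < n ∧
      (n : ℤ) • (Finsupp.single x 1 - Finsupp.single y 1 : Γ.Divisor) ∈ Γ.principal := by
  have h := sub_mem hx.2 hy.2
  rw [sub_sub_sub_cancel_right] at h
  obtain ⟨j, hj, hjxy⟩ := h
  obtain ⟨n, hn, hnj⟩ := isOfFinAddOrder_iff_nsmul_eq_zero.1 hj
  refine ⟨n, hn, ?_⟩
  rw [← QuotientAddGroup.eq_zero_iff]
  change Γ.divisorClass _ = 0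
  rw [map_zsmul, map_sub]
  change (n : ℤ) • (Γ.pointClass x - Γ.pointClass y) = 0
  rw [← hjxy, natCast_zsmul, ← map_nsmul, hnj, map_zero]

theorem torsionPacket_subsingleton [Fintype V] (hG : Γ.graph.IsBiconnected)
    (hg : 2 ≤ Γ.graph.genus)
    (hℓ : ∀ c : E → ℤ, ∑ e, (c e : ℝ) * Γ.length e = 0 → c = 0) (c : Γ.Pic) (e : E) :
    {x ∈ Γ.closedEdge e | Γ.pointClass x ∈ Γ.torsionPacket c}.Subsingleton := by
  have key : ∀ s t, 0 ≤ s → s < t → t ≤ Γ.length e →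
      Γ.pointClass (Γ.edgePoint e s) ∈ Γ.torsionPacket c →
      Γ.pointClass (Γ.edgePoint e t) ∈ Γ.torsionPacket c → False := by
    intro s t hs hst ht h1 h2
    obtain ⟨n, hn, hmem⟩ := exists_nsmul_sub_mem_principal h1 h2
    have := eq_zero_of_zsmul_sub_mem_principal hG hg hℓ hs hst ht hmem
    omega
  rintro _ ⟨⟨s, hs, rfl⟩, hs'⟩ _ ⟨⟨t, ht, rfl⟩, ht'⟩
  rcases lt_trichotomy s t with h | rfl | h
  · exact (key s t hs.1 h ht.2 hs' ht').elim
  · rfl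
  · exact (key t s ht.1 h hs.2 ht' hs').elim

/-- The closed edges are finite in number and, by `hv`, cover all points, so the packet of `q` comes
from finitely many points. -/
theorem maninMumford_of_subsingleton (hv : ∀ v, ∃ e, Γ.graph.tail e = v ∨ Γ.graph.head e = v)
    (h : ∀ c ∈ Γ.effOne, ∀ e : E,
      {x ∈ Γ.closedEdge e | Γ.pointClass x ∈ Γ.torsionPacket c}.Subsingleton) :
    Γ.ManinMumford := by
  intro q
  have hfin : (⋃ e, {x ∈ Γ.closedEdge e |
      Γ.pointClass x ∈ Γ.torsionPacket (Γ.pointClass q)}).Finite :=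
    Set.finite_iUnion fun e => (h _ ⟨q, rfl⟩ e).finite
  refine (hfin.image (Γ.abelJacobi q)).subset ?_
  rintro _ ⟨⟨x, rfl⟩, hx⟩
  obtain ⟨e, he⟩ := exists_edgePoint_eq hv x
  refine ⟨x, Set.mem_iUnion.2 ⟨e, he, ⟨x, rfl⟩, Γ.abelJacobi q x, hx, ?_⟩, rfl⟩
  exact map_sub Γ.divisorClass _ _

end MetricGraph

/-! ### Very general edge lengths -/

lemma OrientedGraph.IsConnected.exists_edge_at {V E : Type*} {G : OrientedGraph V E}
    (hG : G.IsConnected) {e : E} (he : G.head e ≠ G.tail e) (v : V) :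
    ∃ e, G.tail e = v ∨ G.head e = v := by
  obtain ⟨w, hw⟩ : ∃ w, w ≠ v := by
    by_contra! h
    exact he ((h _).trans (h _).symm)
  obtain ⟨d, hd⟩ := hG.exists_crosses (S := {v}) (p := v) rfl hw
  refine ⟨d, ?_⟩
  unfold OrientedGraph.Crosses at hd
  simp only [Set.mem_singleton_iff] at hd
  tauto

/-- The points with `ℤ`-linearly independent coordinates form a very general set. -/
lemma isVeryGeneral_linearIndependent {ι : Type*} [Fintype ι] :
    IsVeryGeneral {a : ι → ℝ | ∀ c : ι → ℤ, ∑ i, (c i : ℝ) * a i = 0 → c = 0} := by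
  classical
  let P : (ι → ℤ) → MvPolynomial ι ℝ := fun c =>
    ∑ i, MvPolynomial.C (c i : ℝ) * MvPolynomial.X i
  have hP : ∀ c a, MvPolynomial.eval a (P c) = ∑ i, (c i : ℝ) * a i := fun c a => by
    simp [P]
  refine ⟨P '' {c | c ≠ 0}, (Set.to_countable _).image _, ?_, ?_⟩
  · rintro _ ⟨c, hc, rfl⟩ h0
    refine hc (funext fun i => ?_)
    -- Evaluating the linear form at the `i`-th unit vector reads off its coefficient `c i`.
    have := hP c (Pi.single i 1)
    rw [h0, map_zero, Finset.sum_eq_single i (by simp +contextual) (by simp)] at this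
    simpa using this.symm
  · intro a ha c hc
    by_contra hne
    exact ha _ ⟨c, hne, rfl⟩ ((hP c a).trans hc)

lemma IsVeryGeneral.mono {ι : Type*} {S T : Set (ι → ℝ)} (hS : IsVeryGeneral S) (h : S ⊆ T) :
    IsVeryGeneral T := by
  obtain ⟨F, h1, h2, h3⟩ := hS
  exact ⟨F, h1, h2, h3.trans h⟩

end Tropical

theorem mainTheorem1 {V E : Type*} [Fintype V] [Fintype E]
    (G : Tropical.OrientedGraph V E) (hG : G.IsBiconnected) (hg : 2 ≤ G.genus) :
    Tropical.IsVeryGeneralIn {ℓ : E → ℝ | ∀ e, 0 < ℓ e}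
      {ℓ : E → ℝ | ∃ Γ : Tropical.MetricGraph V E, Γ.graph = G ∧ Γ.length = ℓ ∧
        Γ.ManinMumford ∧
        ∀ c ∈ Γ.effOne, ∀ e : E,
          {x ∈ Γ.closedEdge e | Γ.pointClass x ∈ Γ.torsionPacket c}.Subsingleton} := by
  set T : Set (E → ℝ) := {ℓ : E → ℝ | ∃ Γ : Tropical.MetricGraph V E, Γ.graph = G ∧ Γ.length = ℓ ∧
        Γ.ManinMumford ∧
        ∀ c ∈ Γ.effOne, ∀ e : E,
          {x ∈ Γ.closedEdge e | Γ.pointClass x ∈ Γ.torsionPacket c}.Subsingleton}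
  -- Independent vectors need not be positive, so the complement of the positive orthant is added;
  -- this does not change the intersection with the orthant.
  refine ⟨T ∪ {ℓ | ∀ e, 0 < ℓ e}ᶜ, Tropical.isVeryGeneral_linearIndependent.mono ?_, ?_⟩
  · intro ℓ hℓ
    by_cases hpos : ∀ e, 0 < ℓ e
    · refine Or.inl ⟨⟨G, ℓ, hpos⟩, rfl, rfl, ?_⟩
      have hsub := fun c (_ : c ∈ Tropical.MetricGraph.effOne ⟨G, ℓ, hpos⟩) e =>
        Tropical.MetricGraph.torsionPacket_subsingleton (Γ := ⟨G, ℓ, hpos⟩) hG hg hℓ c e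
      refine ⟨Tropical.MetricGraph.maninMumford_of_subsingleton ?_ hsub, hsub⟩
      have hE : Nonempty E := by
        have : Nonempty V := hG.1.nonempty
        have hV : 0 < Fintype.card V := Fintype.card_pos
        unfold Tropical.OrientedGraph.genus at hg
        exact Fintype.card_pos_iff.1 (by omega)
      exact hG.1.exists_edge_at (hG.2.1 hE.some)
    · exact Or.inr hpos
  · ext ℓ
    constructor
    · rintro ⟨Γ, h1, rfl, h2⟩
      exact ⟨Γ.length_pos, Or.inl ⟨Γ, h1, rfl, h2⟩⟩
    · rintro ⟨hpos, h | h⟩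
      · exact h
      · exact absurd hpos h
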